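/- All compact spaces are Hausdorff. A compact space is \emph{scattered} if each of its nonempty subsets has an isolated point in its relative topology. A space $X$ is a \emph{CO space} if every closed subset of $X$ is homeomorphic to some clopen subset of $X$. Let $D_0(X)=X$, let $D_{\alpha+1}(X)$ be the set of non-isolated points of the space $D_\alpha(X)$, and let $D_\delta(X)=\bigcap_{\alpha<\delta}D_\alpha(X)$ for limit $\delta$; the \emph{rank} $\operatorname{rk}(X)$ of a compact space $X$ is the least $\alpha$ such that $D_\alpha(X)$ is finite or has no isolated points in its relative topology. A scattered compact space $K$ is \emph{unitary} if $D_{\operatorname{rk}(K)}(K)$ is a singleton; its element is called the top point of $K$ and denoted by $e^K$. For unitary scattered compact spaces $K,L$: \begin{itemize} \item $K\approx L$ if there are clopen neighbourhoods $U\subseteq K$ of $e^K$ and $V\subseteq L$ of $e^L$ which are homeomorphic; \item $K\prec L$ if there is a unitary compact subspace $K'\subseteq L$ with $K'\approx K$, and moreover $\operatorname{rk}(K)=\operatorname{rk}(L)$ and $K\not\approx L$; \item $K\prec^{\mathrm w}L$ if there is a unitary compact subspace $K'\subseteq L$ with $K'\approx K$ and $e^{K'}=e^L$, and moreover $K\not\approx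 L$. \end{itemize} A \emph{clopen strong Hausdorff system} for a subset $D$ of $X$ is a family $\{V_d : d\in D\}$ of pairwise disjoint clopen subsets of $X$ (that is, $V_d\cap V_e=\emptyset$ for distinct $d,e\in D$) such that $d\in V_d$ for every $d\in D$ and $\operatorname{cl}(\bigcup_{d\in D}V_d)=\bigcup_{d\in D}\operatorname{cl}(V_d)\cup\operatorname{cl}(D)$. \textbf{Theorem.} Let $X$ be a scattered compact space, and assume that for every subset $S\subseteq X$ whose cardinality is an (infinite) regular cardinal there is $D\subseteq S$ such that $|D|=|S|$ and $D$ has a clopen strong Hausdorff system. (a) Suppose that there are unitary scattered compact spaces $L$ and $M$ with $M\prec L$, and a family $\{L_i : i\in\omega\}$ of unitary compact subspaces of $X$ such that $L_i\approx L$ for every $i$ and $e^{L_i}\neq e^{L_j}$ for all $i<j<\omega$. Then $X$ is not a CO space. (b) Suppose that there are unitary scattered compact spaces $K$, $L$ and $M$ such that $K$ is a subspace of $X$ and $M\prec L\prec^{\mathrm w}K$. Then $X$ is not a CO space. -/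

import Mathlib

universe u

namespace COSpace

/-- Every nonempty subset has an isolated point in its relative topology. -/
def IsScattered (X : Type u) [TopologicalSpace X] : Prop :=
  ∀ S : Set X, S.Nonempty → ∃ x ∈ S, ∃ U : Set X, IsOpen U ∧ U ∩ S = {x}

/-- The `α`-th Cantor-Bendixson derivative `D_α(X)` of the space `X`. -/
def cbDeriv (X : Type u) [TopologicalSpace X] (α : Ordinal.{u}) : Set X :=
  CantorBendixson.iteratedDerivedSet (Set.univ : Set X) α

/-- The rank of `X`: the first ordinal `α` such that `D_α(X)` is finite or has no isolated points
in its relative topology. -/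
noncomputable def rk (X : Type u) [TopologicalSpace X] : Ordinal.{u} :=
  sInf {α | (cbDeriv X α).Finite ∨ Preperfect (cbDeriv X α)}

/-- The set in the definition of the rank is nonempty, so the infimum is attained. -/
theorem rk_mem (X : Type u) [TopologicalSpace X] :
    (cbDeriv X (rk X)).Finite ∨ Preperfect (cbDeriv X (rk X)) := by
  have h : {α | (cbDeriv X α).Finite ∨ Preperfect (cbDeriv X α)}.Nonempty := by
    obtain ⟨a, ha⟩ := CantorBendixson.iteratedDerivedSet_mem_fixedPoints (Set.univ : Set X)
    exact ⟨a, Or.inr (preperfect_iff_eq_relDerivedSet.mpr (Function.mem_fixedPoints_iff.mp ha).symm)⟩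
  exact csInf_mem h

/-- `K` is a unitary scattered compact (Hausdorff) space: `D_{rk(K)}(K)` is a singleton. -/
structure IsUnitary (K : Type u) [TopologicalSpace K] : Prop where
  compact : CompactSpace K
  t2 : T2Space K
  scattered : IsScattered K
  exists_top : ∃ e : K, cbDeriv K (rk K) = {e}

/-- The top point `e^K` of a unitary space `K`: the unique element of `D_{rk(K)}(K)`. -/
noncomputable def IsUnitary.top {K : Type u} [TopologicalSpace K] (h : IsUnitary K) : K :=
  h.exists_top.choose

theorem IsUnitary.cbDeriv_rk {K : Type u} [TopologicalSpace K] (h : IsUnitary K) :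
    cbDeriv K (rk K) = {h.top} :=
  h.exists_top.choose_spec

/-- `K ≈ L`: the unitary spaces `K` and `L` are almost homeomorphic. -/
def AlmostHomeo {K L : Type u} [TopologicalSpace K] [TopologicalSpace L]
    (hK : IsUnitary K) (hL : IsUnitary L) : Prop :=
  ∃ (U : Set K) (V : Set L), IsClopen U ∧ hK.top ∈ U ∧ IsClopen V ∧ hL.top ∈ V ∧
    Nonempty (U ≃ₜ V)

/-- `K ≺ʷ L`: for some `K' ≈ K`, `K' ⊆ L`, the top points of `K'` and `L` coincide,
and `K ≉ L`. -/
def WPrec {K L : Type u} [TopologicalSpace K] [TopologicalSpace L]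
    (hK : IsUnitary K) (hL : IsUnitary L) : Prop :=
  (∃ (K' : Set L) (hK' : IsUnitary K'), AlmostHomeo hK' hK ∧ (hK'.top : L) = hL.top) ∧
    ¬ AlmostHomeo hK hL

/-- `K ≺ L`: for some `K' ≈ K`, `K' ⊆ L`, and moreover `rk(K) = rk(L)` and `K ≉ L`. -/
def Prec {K L : Type u} [TopologicalSpace K] [TopologicalSpace L]
    (hK : IsUnitary K) (hL : IsUnitary L) : Prop :=
  (∃ (K' : Set L) (hK' : IsUnitary K'), AlmostHomeo hK' hK) ∧ rk K = rk L ∧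
    ¬ AlmostHomeo hK hL

/-- The family `{V d | d ∈ D}` is a clopen strong Hausdorff system for `D`. Only the values of
`V` on `D` matter. -/
structure IsClopenStrongHausdorffSystem {X : Type u} [TopologicalSpace X]
    (D : Set X) (V : X → Set X) : Prop where
  isClopen : ∀ d ∈ D, IsClopen (V d)
  mem : ∀ d ∈ D, d ∈ V d
  disjoint : ∀ d ∈ D, ∀ e ∈ D, d ≠ e → V d ∩ V e = ∅
  closure_eq : closure (⋃ d ∈ D, V d) = (⋃ d ∈ D, closure (V d)) ∪ closure D

/-- Every closed subset of `X` is homeomorphic to some clopen subset of `X`. -/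
def IsCO (X : Type u) [TopologicalSpace X] : Prop :=
  ∀ F : Set X, IsClosed F → ∃ U : Set X, IsClopen U ∧ Nonempty (F ≃ₜ U)

end COSpace

section

open Set Topology Filter CantorBendixson

namespace COSpace

/-! ### Cantor-Bendixson derivatives and scattered spaces -/

variable {X Y Z : Type u} [TopologicalSpace X] [TopologicalSpace Y] [TopologicalSpace Z]

/-! The relation `AlmostHomeo` only concerns germs: it says that the spaces are locally homeomorphic
at their tops (`SameGerm`). Let `e` and `m` be the tops of `L` and `M`. Since the ranks agree, `M ≺
L` says that a closed subset of `L` containing `e` has the germ of `m` there, while `e` and `m` have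
the same Cantor-Bendixson level but different germs. Strong Hausdorff systems provide closed
subspaces with prescribed germs: `attach D N` is closed and looks like `N d` near each `d ∈ D`.

The core is `not_isCO_of_infinite_sameGerm`: a CO space has only finitely many points with the germ
of `e`. Suppose the set `T` of such points is infinite. Consider subsets `D` of `T` with a system,
coloured so that each colour accumulates on all of `closure D \ D`. There is a largest rank `γ`
attained in such sets `closure D \ D`; the set `P` of points attaining it is finite, and one `D`
serves all of `P` (`exists_isColored_maximal`). If a closed subspace contains `closure D` and keeps
the germ of `e` on `D`, its clopen embedding into `X` maps `P` injectively into `P`, hence onto `P`.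
Apply this to two subspaces. In the first the germ of `m` occurs nowhere; in the second it occurs at
every point of colour `0`, the other colours sufficing to preserve `P`. The image of the first is a
neighbourhood of each point of `P`, while the image of the second has points with germ `m`
arbitrarily close to it. These points lie in the open image of the first, a contradiction.

If infinitely many points carry the germ of `e` only in closed subspaces, one attached subspace and
the CO property produce infinitely many in `X` itself. So `germPoints X e` is finite in a CO space,
which is (a). By finiteness, each of these points then has the germ of `e` in `X`. In (b), the top
of a clopen copy of `K` is such a point, so `K ≈ L`, contrary to `L ≺ʷ K`. -/

theorem iteratedDerivedSet_subset (A : Set X) (α : Ordinal.{u}) : iteratedDerivedSet A α ⊆ A := by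
  simpa using iteratedDerivedSet_antitone A (zero_le (a := α))

theorem mem_iteratedDerivedSet_succ {A : Set X} {α : Ordinal.{u}} {x : X} :
    x ∈ iteratedDerivedSet A (α + 1) ↔
      x ∈ iteratedDerivedSet A α ∧ AccPt x (𝓟 (iteratedDerivedSet A α)) := by
  rw [iteratedDerivedSet_succ, relDerivedSet_apply]
  exact and_comm

theorem accPt_image_iff {i : Y → X} (hi : IsEmbedding i) {B : Set Y} {y : Y} :
    AccPt (i y) (𝓟 (i '' B)) ↔ AccPt y (𝓟 B) := by
  rw [accPt_iff_nhds, accPt_iff_nhds]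
  constructor
  · intro h U hU
    rw [hi.nhds_eq_comap] at hU
    obtain ⟨V, hV, hVU⟩ := hU
    obtain ⟨_, ⟨hxV, b, hb, rfl⟩, hne⟩ := h V hV
    exact ⟨b, ⟨hVU hxV, hb⟩, fun h => hne (by rw [h])⟩
  · intro h U hU
    obtain ⟨b, ⟨hbU, hb⟩, hne⟩ := h _ (hi.continuous.continuousAt.preimage_mem_nhds hU)
    exact ⟨i b, ⟨hbU, mem_image_of_mem _ hb⟩, fun h => hne (hi.injective h)⟩

/-- Iterated derived sets are computed inside any ambient space. -/
theorem iteratedDerivedSet_image {i : Y → X} (hi : IsEmbedding i) (B : Set Y) (α : Ordinal.{u}) :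
    iteratedDerivedSet (i '' B) α = i '' iteratedDerivedSet B α := by
  induction α using Ordinal.limitRecOn with
  | zero => simp
  | add_one α ih =>
    ext x
    rw [mem_iteratedDerivedSet_succ, ih]
    constructor
    · rintro ⟨⟨y, hy, rfl⟩, hacc⟩
      exact ⟨y, mem_iteratedDerivedSet_succ.2 ⟨hy, (accPt_image_iff hi).1 hacc⟩, rfl⟩
    · rintro ⟨y, hy, rfl⟩
      rw [mem_iteratedDerivedSet_succ] at hy
      exact ⟨mem_image_of_mem _ hy.1, (accPt_image_iff hi).2 hy.2⟩
  | limit α hα ih =>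
    have : Nonempty (Iio α) := ⟨⟨0, hα.bot_lt⟩⟩
    rw [iteratedDerivedSet_limit hα, iteratedDerivedSet_limit hα, hi.injective.injOn.image_iInter_eq]
    exact iInter_congr fun b => ih b b.2

/-- Iterated derived sets are local. -/
theorem mem_iteratedDerivedSet_congr {A B O : Set X} (hO : IsOpen O)
    (h : ∀ x ∈ O, x ∈ A ↔ x ∈ B) (α : Ordinal.{u}) {x : X} (hx : x ∈ O) :
    x ∈ iteratedDerivedSet A α ↔ x ∈ iteratedDerivedSet B α := by
  induction α using Ordinal.limitRecOn generalizing x with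
  | zero => simpa using h x hx
  | add_one α ih =>
    have key : ∀ A' B' : Set X, (∀ x ∈ O, x ∈ A' ↔ x ∈ B') → AccPt x (𝓟 A') → AccPt x (𝓟 B') := by
      intro A' B' hAB hA
      rw [accPt_iff_nhds] at hA ⊢
      intro U hU
      obtain ⟨y, ⟨⟨hyU, hyO⟩, hyA⟩, hne⟩ := hA _ (inter_mem hU (hO.mem_nhds hx))
      exact ⟨y, ⟨hyU, (hAB y hyO).1 hyA⟩, hne⟩
    rw [mem_iteratedDerivedSet_succ, mem_iteratedDerivedSet_succ, ih hx]
    exact and_congr_right fun _ =>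
      ⟨key _ _ fun y hy => ih hy, key _ _ fun y hy => (ih hy).symm⟩
  | limit α hα ih =>
    rw [iteratedDerivedSet_limit hα, iteratedDerivedSet_limit hα, mem_iInter, mem_iInter]
    exact forall_congr' fun b => ih b b.2 hx

theorem mem_cbDeriv_of_isOpenEmbedding {i : Y → X} (hi : IsOpenEmbedding i) (α : Ordinal.{u})
    {y : Y} : i y ∈ cbDeriv X α ↔ y ∈ cbDeriv Y α := by
  have h := mem_iteratedDerivedSet_congr (A := univ) (B := i '' univ) hi.isOpen_range
    (fun x hx => by simpa using hx) α (mem_range_self y)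
  rw [cbDeriv, h, iteratedDerivedSet_image hi.isEmbedding, hi.injective.mem_set_image, cbDeriv]

theorem mem_cbDeriv_of_isEmbedding {i : Y → X} (hi : IsEmbedding i) {α : Ordinal.{u}}
    {y : Y} (hy : y ∈ cbDeriv Y α) : i y ∈ cbDeriv X α := by
  have : i y ∈ iteratedDerivedSet (i '' univ) α := by
    rw [iteratedDerivedSet_image hi]; exact mem_image_of_mem _ hy
  exact iteratedDerivedSet_mono (subset_univ _) _ this

theorem IsScattered.iteratedDerivedSet_eq_empty (hX : IsScattered X) (A : Set X) :
    ∃ α : Ordinal.{u}, iteratedDerivedSet A α = ∅ := by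
  obtain ⟨α, hα⟩ := iteratedDerivedSet_mem_fixedPoints A
  refine ⟨α, not_nonempty_iff_eq_empty.1 fun hne => ?_⟩
  obtain ⟨x, hx, U, hU, hUx⟩ := hX _ hne
  have hfix := Function.mem_fixedPoints_iff.1 hα
  have hx' := hx
  rw [← hfix, relDerivedSet_apply] at hx'
  have hxU : x ∈ U := (hUx.ge (mem_singleton x)).1
  obtain ⟨y, hy, hne⟩ := accPt_iff_nhds.1 hx'.1 U (hU.mem_nhds hxU)
  exact hne (hUx.le hy)

/-- An isolated point of a connected set is clopen in it, so it is the whole set. -/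
theorem IsScattered.totallyDisconnectedSpace [T1Space X] (hX : IsScattered X) :
    TotallyDisconnectedSpace X := by
  refine ⟨fun S _ hS x hx => ?_⟩
  obtain ⟨z, hz, U, hU, hUz⟩ := hX S ⟨x, hx⟩
  have hzU : z ∈ U := (hUz.ge (mem_singleton z)).1
  have h : ∀ y ∈ S, y = z := by
    intro y hy
    by_contra hne
    obtain ⟨w, hwS, hwU, hwz⟩ := hS U {z}ᶜ hU isOpen_compl_singleton
      (fun w _ => by by_cases hw : w = z <;> simp [hw, hzU]) ⟨z, hz, hzU⟩ ⟨y, hy, hne⟩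
    exact hwz (hUz.le ⟨hwU, hwS⟩)
  intro y hy
  rw [h x hx, h y hy]

theorem IsScattered.exists_isClopen [CompactSpace X] [T2Space X] (hX : IsScattered X)
    {x : X} {U : Set X} (hU : IsOpen U) (hx : x ∈ U) : ∃ V, IsClopen V ∧ x ∈ V ∧ V ⊆ U :=
  have := hX.totallyDisconnectedSpace
  compact_exists_isClopen_in_isOpen hU hx

/-! ### Germs of pointed spaces -/

/-- The pointed spaces `(X, x)` and `(Y, y)` are locally homeomorphic. -/
def SameGerm (x : X) (y : Y) : Prop :=
  ∃ φ : OpenPartialHomeomorph X Y, x ∈ φ.source ∧ φ x = y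

theorem SameGerm.symm {x : X} {y : Y} (h : SameGerm x y) : SameGerm y x := by
  obtain ⟨φ, hx, rfl⟩ := h
  exact ⟨φ.symm, φ.map_source hx, φ.left_inv hx⟩

theorem SameGerm.trans {x : X} {y : Y} {z : Z} (h : SameGerm x y) (h' : SameGerm y z) :
    SameGerm x z := by
  obtain ⟨φ, hx, rfl⟩ := h
  obtain ⟨ψ, hy, rfl⟩ := h'
  exact ⟨φ.trans ψ, by simp [hx, hy], by simp⟩

theorem SameGerm.of_isOpenEmbedding {i : Y → X} (hi : IsOpenEmbedding i) (y : Y) :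
    SameGerm y (i y) :=
  have : Nonempty Y := ⟨y⟩
  ⟨hi.toOpenPartialHomeomorph i, by simp, by simp⟩

theorem SameGerm.mem_cbDeriv_iff {x : X} {y : Y} (h : SameGerm x y) (α : Ordinal.{u}) :
    x ∈ cbDeriv X α ↔ y ∈ cbDeriv Y α := by
  obtain ⟨φ, hx, rfl⟩ := h
  rw [show x = Subtype.val (⟨x, hx⟩ : φ.source) from rfl,
    mem_cbDeriv_of_isOpenEmbedding φ.open_source.isOpenEmbedding_subtypeVal]
  exact (mem_cbDeriv_of_isOpenEmbedding φ.isOpenEmbedding_restrict α).symm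

/-- Two subspaces that agree near a point have the same germ there. -/
theorem SameGerm.of_isEmbedding {i : Y → X} {j : Z → X} (hi : IsEmbedding i) (hj : IsEmbedding j)
    {y : Y} {z : Z} (hyz : i y = j z) {O : Set X} (hO : IsOpen O) (hy : i y ∈ O)
    (h : ∀ x ∈ O, x ∈ range i ↔ x ∈ range j) : SameGerm y z := by
  have hmem : ∀ w : i ⁻¹' O, ∃ v, j v = i w := fun w => (h _ w.2).1 (mem_range_self _)
  choose f hf using hmem
  have hjf : j ∘ f = i ∘ Subtype.val := funext hf
  have hcont : Continuous f := by
    rw [hj.continuous_iff, hjf]; exact hi.continuous.comp continuous_subtype_val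
  have hemb : IsEmbedding f := by
    refine IsEmbedding.of_comp hcont hj.continuous ?_
    rw [hjf]; exact hi.comp .subtypeVal
  have hrange : range f = j ⁻¹' O := by
    ext v
    constructor
    · rintro ⟨w, rfl⟩; rw [mem_preimage, hf]; exact w.2
    · intro hv
      obtain ⟨w, hw⟩ := (h _ hv).2 (mem_range_self _)
      exact ⟨⟨w, by rw [mem_preimage, hw]; exact hv⟩, hj.injective (by rw [hf, hw])⟩
  have hfo : IsOpenEmbedding f := ⟨hemb, by rw [hrange]; exact hO.preimage hj.continuous⟩
  have h1 := SameGerm.of_isOpenEmbedding (hO.preimage hi.continuous).isOpenEmbedding_subtypeVal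
    (⟨y, hy⟩ : i ⁻¹' O)
  have h2 := SameGerm.of_isOpenEmbedding hfo (⟨y, hy⟩ : i ⁻¹' O)
  have h3 : f ⟨y, hy⟩ = z := hj.injective (by rw [hf, hyz])
  rw [h3] at h2
  exact h1.symm.trans h2

theorem SameGerm.of_subset {A B O : Set X} {x : X} (hA : x ∈ A) (hB : x ∈ B) (hO : IsOpen O)
    (hx : x ∈ O) (h : ∀ y ∈ O, y ∈ A ↔ y ∈ B) : SameGerm (⟨x, hA⟩ : A) (⟨x, hB⟩ : B) :=
  SameGerm.of_isEmbedding .subtypeVal .subtypeVal rfl hO hx (by simpa using h)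

theorem SameGerm.of_subset_univ {A O : Set X} {x : X} (hA : x ∈ A) (hO : IsOpen O)
    (hx : x ∈ O) (h : O ⊆ A) : SameGerm (⟨x, hA⟩ : A) x :=
  SameGerm.of_isEmbedding .subtypeVal .id rfl hO hx fun y hy => by simpa using h hy

theorem SameGerm.of_openPartialHomeomorph (φ : OpenPartialHomeomorph X Y) {A O : Set X} {B : Set Y}
    {x : X} (hA : x ∈ A) (hB : φ x ∈ B) (hO : IsOpen O) (hx : x ∈ O) (hOφ : O ⊆ φ.source)
    (h : ∀ y ∈ O, y ∈ A ↔ φ y ∈ B) : SameGerm (⟨x, hA⟩ : A) (⟨φ x, hB⟩ : B) := by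
  have h1 : SameGerm (⟨x, hA, hx⟩ : ↥(A ∩ O)) (⟨x, hA⟩ : A) :=
    SameGerm.of_subset _ _ hO hx fun y hy => by simp [hy]
  refine h1.symm.trans ?_
  have hsub : A ∩ O ⊆ φ.source := inter_subset_right.trans hOφ
  refine SameGerm.of_isEmbedding (i := φ.source.domRestrict φ ∘ inclusion hsub) (j := Subtype.val)
    (φ.isOpenEmbedding_restrict.isEmbedding.comp (.inclusion hsub)) .subtypeVal rfl
    (φ.isOpen_image_of_subset_source hO hOφ) (mem_image_of_mem _ hx) ?_
  rintro _ ⟨y, hy, rfl⟩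
  rw [Subtype.range_val, ← h y hy]
  constructor
  · rintro ⟨⟨w, hwA, hwO⟩, hw⟩
    have : w = y := φ.injOn (hOφ hwO) (hOφ hy) hw
    exact this ▸ hwA
  · intro hyA
    exact ⟨⟨y, hyA, hy⟩, rfl⟩

theorem IsUnitary.mem_cbDeriv_rk (h : IsUnitary X) : h.top ∈ cbDeriv X (rk X) := by
  rw [h.cbDeriv_rk]; exact mem_singleton _

theorem IsUnitary.cbDeriv_succ_rk (h : IsUnitary X) : cbDeriv X (rk X + 1) = ∅ := by
  refine eq_empty_of_forall_notMem fun x hx => ?_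
  obtain ⟨hx, hacc⟩ := mem_iteratedDerivedSet_succ.1 hx
  have h1 : iteratedDerivedSet (univ : Set X) (rk X) = {h.top} := h.cbDeriv_rk
  rw [h1] at hx hacc
  obtain ⟨y, hy, hne⟩ := accPt_iff_nhds.1 hacc univ univ_mem
  exact hne (hy.2.trans hx.symm)

theorem IsUnitary.cbDeriv_eq_empty_of_lt (h : IsUnitary X) {α : Ordinal.{u}} (hα : rk X < α) :
    cbDeriv X α = ∅ := by
  refine subset_empty_iff.1 (h.cbDeriv_succ_rk ▸ iteratedDerivedSet_antitone _ ?_)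
  exact Order.add_one_le_of_lt hα

/-- Derivatives are local and vanish beyond the rank, so the image of the top bounds the rank of `L`
from below. With equal ranks it lies in the last nonempty derivative, which is a singleton. Hence
almost homeomorphisms match tops. -/
theorem rk_le_of_homeomorph {K L : Type u} [TopologicalSpace K] [TopologicalSpace L]
    (hK : IsUnitary K) (hL : IsUnitary L) {U : Set K} {V : Set L} (hU : IsOpen U) (hV : IsOpen V)
    (htop : hK.top ∈ U) (e : U ≃ₜ V) :
    rk K ≤ rk L ∧ (rk K = rk L → (e ⟨hK.top, htop⟩ : L) = hL.top) := by
  have hmem : (e ⟨hK.top, htop⟩ : L) ∈ cbDeriv L (rk K) := by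
    rw [mem_cbDeriv_of_isOpenEmbedding hV.isOpenEmbedding_subtypeVal,
      mem_cbDeriv_of_isOpenEmbedding e.isOpenEmbedding,
      ← mem_cbDeriv_of_isOpenEmbedding hU.isOpenEmbedding_subtypeVal]
    exact hK.mem_cbDeriv_rk
  constructor
  · by_contra! hlt
    rw [hL.cbDeriv_eq_empty_of_lt hlt] at hmem
    exact hmem
  · intro heq
    rw [heq, hL.cbDeriv_rk] at hmem
    exact hmem

theorem AlmostHomeo.rk_eq {K L : Type u} [TopologicalSpace K] [TopologicalSpace L]
    {hK : IsUnitary K} {hL : IsUnitary L} (h : AlmostHomeo hK hL) : rk K = rk L := by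
  obtain ⟨U, V, hU, hKU, hV, hLV, ⟨e⟩⟩ := h
  exact le_antisymm (rk_le_of_homeomorph hK hL hU.isOpen hV.isOpen hKU e).1
    (rk_le_of_homeomorph hL hK hV.isOpen hU.isOpen hLV e.symm).1

theorem AlmostHomeo.sameGerm {K L : Type u} [TopologicalSpace K] [TopologicalSpace L]
    {hK : IsUnitary K} {hL : IsUnitary L} (h : AlmostHomeo hK hL) : SameGerm hK.top hL.top := by
  have hrk := h.rk_eq
  obtain ⟨U, V, hU, hKU, hV, hLV, ⟨e⟩⟩ := h
  rw [← (rk_le_of_homeomorph hK hL hU.isOpen hV.isOpen hKU e).2 hrk]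
  exact (SameGerm.of_isOpenEmbedding hU.isOpen.isOpenEmbedding_subtypeVal ⟨_, hKU⟩).symm.trans
    (SameGerm.of_isOpenEmbedding (hV.isOpen.isOpenEmbedding_subtypeVal.comp e.isOpenEmbedding) _)

/-- Shrink the domain of the partial homeomorphism to a clopen neighbourhood; its image is open, and
closed because compact. -/
theorem SameGerm.almostHomeo {K L : Type u} [TopologicalSpace K] [TopologicalSpace L]
    {hK : IsUnitary K} {hL : IsUnitary L} (h : SameGerm hK.top hL.top) : AlmostHomeo hK hL := by
  have := hK.compact
  have := hK.t2
  have := hL.t2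
  obtain ⟨φ, hx, hφ⟩ := h
  obtain ⟨U, hU, hxU, hUφ⟩ := hK.scattered.exists_isClopen φ.open_source hx
  refine ⟨U, φ '' U, hU, hxU, ⟨?_, φ.isOpen_image_of_subset_source hU.isOpen hUφ⟩,
    ⟨_, hxU, hφ⟩, ?_⟩
  · exact (hU.isClosed.isCompact.image_of_continuousOn (φ.continuousOn.mono hUφ)).isClosed
  · have hemb : IsEmbedding (φ.source.domRestrict φ ∘ inclusion hUφ) :=
      φ.isOpenEmbedding_restrict.isEmbedding.comp (.inclusion hUφ)
    refine ⟨hemb.toHomeomorph.trans (Homeomorph.setCongr ?_)⟩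
    ext y
    simp [domRestrict]

/-! ### Clopen strong Hausdorff systems -/

namespace IsClopenStrongHausdorffSystem

variable {D : Set X} {V : X → Set X}

theorem of_closure_subset (hV : ∀ d ∈ D, IsClopen (V d)) (hmem : ∀ d ∈ D, d ∈ V d)
    (hdisj : ∀ d ∈ D, ∀ e ∈ D, ∀ x ∈ V d, x ∈ V e → d = e)
    (hcl : ∀ x ∈ closure (⋃ d ∈ D, V d), (∃ d ∈ D, x ∈ V d) ∨ x ∈ closure D) :
    IsClopenStrongHausdorffSystem D V where
  isClopen := hV
  mem := hmem
  disjoint d hd e he hne :=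
    eq_empty_of_forall_notMem fun x hx => hne (hdisj d hd e he x hx.1 hx.2)
  closure_eq := by
    refine Subset.antisymm (fun x hx => ?_) (union_subset ?_ ?_)
    · obtain ⟨d, hd, hxd⟩ | h := hcl x hx
      · exact Or.inl (mem_biUnion hd (subset_closure hxd))
      · exact Or.inr h
    · exact iUnion₂_subset fun d hd => closure_mono (subset_biUnion_of_mem hd)
    · exact closure_mono fun d hd => mem_biUnion hd (hmem d hd)

theorem mem_or_of_mem_closure (h : IsClopenStrongHausdorffSystem D V) {x : X}
    (hx : x ∈ closure (⋃ d ∈ D, V d)) : (∃ d ∈ D, x ∈ V d) ∨ x ∈ closure D := by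
  rw [h.closure_eq] at hx
  refine hx.imp_left fun hx => ?_
  obtain ⟨d, hd, hxd⟩ := mem_iUnion₂.1 hx
  exact ⟨d, hd, (h.isClopen d hd).isClosed.closure_eq ▸ hxd⟩

theorem eq_of_mem (h : IsClopenStrongHausdorffSystem D V) {d e x : X} (hd : d ∈ D) (he : e ∈ D)
    (hxd : x ∈ V d) (hxe : x ∈ V e) : d = e := by
  by_contra hne
  exact (h.disjoint d hd e he hne).le ⟨hxd, hxe⟩

/-- The open set `V d` misses every other `V e`, so inside it a union of pieces has only the piece
of `d`. Closures are computed piecewise on the system by this. -/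
theorem mem_closure_of_mem (h : IsClopenStrongHausdorffSystem D V) {A : X → Set X}
    (hA : ∀ d ∈ D, A d ⊆ V d) {d x : X} (hd : d ∈ D) (hxd : x ∈ V d) {D' : Set X} (hD' : D' ⊆ D)
    (hx : x ∈ closure (⋃ d ∈ D', A d)) : d ∈ D' ∧ x ∈ closure (A d) := by
  have key : ∀ U : Set X, IsOpen U → x ∈ U → d ∈ D' ∧ (U ∩ A d).Nonempty := by
    intro U hU hxU
    obtain ⟨y, ⟨hyU, hyd⟩, hy⟩ :=
      mem_closure_iff.1 hx (U ∩ V d) (hU.inter (h.isClopen d hd).isOpen) ⟨hxU, hxd⟩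
    obtain ⟨e, he, hye⟩ := mem_iUnion₂.1 hy
    obtain rfl := h.eq_of_mem hd (hD' he) hyd (hA e (hD' he) hye)
    exact ⟨he, y, hyU, hye⟩
  exact ⟨(key univ isOpen_univ trivial).1, mem_closure_iff.2 fun U hU hxU => (key U hU hxU).2⟩

theorem eq_of_mem_closure [T1Space X] (h : IsClopenStrongHausdorffSystem D V) {d x : X}
    (hd : d ∈ D) (hxd : x ∈ V d) {D' : Set X} (hD' : D' ⊆ D) (hx : x ∈ closure D') :
    d ∈ D' ∧ x = d := by
  have := h.mem_closure_of_mem (A := fun d => {d}) (D' := D')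
    (fun e he => singleton_subset_iff.2 (h.mem e he)) hd hxd hD' (by simpa using hx)
  simpa using this

theorem isClosed_closure_diff [T1Space X] (h : IsClopenStrongHausdorffSystem D V) :
    IsClosed (closure D \ D) := by
  have : closure D \ D = closure D \ ⋃ d ∈ D, V d := by
    ext x
    refine and_congr_right fun hx => not_congr ⟨fun hxD => mem_biUnion hxD (h.mem x hxD), ?_⟩
    intro hx'
    obtain ⟨d, hd, hxd⟩ := mem_iUnion₂.1 hx'
    exact (h.eq_of_mem_closure hd hxd Subset.rfl hx).2 ▸ hd
  rw [this]
  exact isClosed_closure.sdiff (isOpen_biUnion fun d hd => (h.isClopen d hd).isOpen)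

theorem inter (h : IsClopenStrongHausdorffSystem D V) {W : Set X} (hW : IsClopen W) :
    IsClopenStrongHausdorffSystem (D ∩ W) fun d => V d ∩ W := by
  refine of_closure_subset (fun d hd => (h.isClopen d hd.1).inter hW)
    (fun d hd => ⟨h.mem d hd.1, hd.2⟩)
    (fun d hd e he x hxd hxe => h.eq_of_mem hd.1 he.1 hxd.1 hxe.1) fun x hx => ?_
  have hxW : x ∈ W := hW.isClosed.closure_subset_iff.2
    (iUnion₂_subset fun d _ => inter_subset_right) hx
  have hx' : x ∈ closure (⋃ d ∈ D, V d) :=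
    closure_mono (iUnion₂_subset fun d hd => inter_subset_left.trans
      (subset_biUnion_of_mem (u := V) hd.1)) hx
  obtain ⟨d, hd, hxd⟩ | hcl := h.mem_or_of_mem_closure hx'
  · have := h.mem_closure_of_mem (A := fun d => V d ∩ W) (fun d _ => inter_subset_left) hd hxd
      inter_subset_left hx
    exact Or.inl ⟨d, this.1, hxd, hxW⟩
  · refine Or.inr (mem_closure_iff.2 fun U hU hxU => ?_)
    obtain ⟨y, ⟨hyU, hyW⟩, hyD⟩ := mem_closure_iff.1 hcl (U ∩ W) (hU.inter hW.isOpen) ⟨hxU, hxW⟩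
    exact ⟨y, hyU, hyD, hyW⟩

/-- Removing points keeps the system if the remaining points accumulate at the same places. -/
theorem mono [T1Space X] (h : IsClopenStrongHausdorffSystem D V) {D' : Set X} (hD' : D' ⊆ D)
    (hacc : closure D \ D ⊆ closure D') : IsClopenStrongHausdorffSystem D' V := by
  refine of_closure_subset (fun d hd => h.isClopen d (hD' hd)) (fun d hd => h.mem d (hD' hd))
    (fun d hd e he x => h.eq_of_mem (hD' hd) (hD' he)) fun x hx => ?_
  have key : ∀ d ∈ D, x ∈ V d → ∃ d ∈ D', x ∈ V d := fun d hd hxd =>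
    ⟨d, (h.mem_closure_of_mem (A := V) (fun d _ => Subset.rfl) hd hxd hD' hx).1, hxd⟩
  obtain ⟨d, hd, hxd⟩ | hcl := h.mem_or_of_mem_closure (closure_mono (biUnion_mono hD'
    fun _ _ => Subset.rfl) hx)
  · exact Or.inl (key d hd hxd)
  · by_cases hxD : x ∈ D
    · exact Or.inl (key x hxD (h.mem x hxD))
    · exact Or.inr (hacc ⟨hcl, hxD⟩)

theorem map {j : Y → X} (hj : IsOpenEmbedding j) (hjc : IsClosedEmbedding j) {D : Set Y}
    {V : Y → Set Y} (h : IsClopenStrongHausdorffSystem D V) :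
    IsClopenStrongHausdorffSystem (j '' D) (Function.extend j (fun y => j '' V y) fun _ => ∅) := by
  have hext : ∀ y, Function.extend j (fun y => j '' V y) (fun _ => ∅) (j y) = j '' V y :=
    fun y => hj.injective.extend_apply _ _ _
  refine of_closure_subset ?_ ?_ ?_ ?_
  · rintro _ ⟨d, hd, rfl⟩
    rw [hext]
    exact ⟨hjc.isClosedMap _ (h.isClopen d hd).isClosed, hj.isOpenMap _ (h.isClopen d hd).isOpen⟩
  · rintro _ ⟨d, hd, rfl⟩
    rw [hext]
    exact mem_image_of_mem _ (h.mem d hd)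
  · rintro _ ⟨d, hd, rfl⟩ _ ⟨e, he, rfl⟩ x hxd hxe
    rw [hext] at hxd hxe
    obtain ⟨y, hy, rfl⟩ := hxd
    rw [hj.injective.mem_set_image] at hxe
    rw [h.eq_of_mem hd he hy hxe]
  · intro x hx
    have heq : (⋃ d ∈ j '' D, Function.extend j (fun y => j '' V y) (fun _ => ∅) d) =
        j '' ⋃ d ∈ D, V d := by
      rw [biUnion_image, image_iUnion₂]
      simp_rw [hext]
    rw [heq, hjc.closure_image_eq] at hx
    obtain ⟨y, hy, rfl⟩ := hx
    rw [hjc.closure_image_eq, hj.injective.mem_set_image]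
    refine (h.mem_or_of_mem_closure hy).imp_left ?_
    rintro ⟨d, hd, hyd⟩
    exact ⟨j d, mem_image_of_mem _ hd, by rw [hext]; exact mem_image_of_mem _ hyd⟩

theorem comap (h : IsClopenStrongHausdorffSystem D V) {F : Set X} (hDF : D ⊆ F) :
    IsClopenStrongHausdorffSystem (Subtype.val ⁻¹' D : Set F) fun d => Subtype.val ⁻¹' V d := by
  refine of_closure_subset (fun d hd => (h.isClopen d hd).preimage continuous_subtype_val)
    (fun d hd => h.mem d hd)
    (fun d hd e he x hxd hxe => Subtype.ext (h.eq_of_mem hd he hxd hxe)) fun x hx => ?_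
  have hx' : (x : X) ∈ closure (⋃ d ∈ D, V d) := by
    refine closure_mono ?_ (image_closure_subset_closure_image continuous_subtype_val
      (mem_image_of_mem _ hx))
    rintro _ ⟨y, hy, rfl⟩
    obtain ⟨d, hd, hyd⟩ := mem_iUnion₂.1 hy
    exact mem_biUnion hd hyd
  obtain ⟨d, hd, hxd⟩ | hcl := h.mem_or_of_mem_closure hx'
  · exact Or.inl ⟨⟨d, hDF hd⟩, hd, hxd⟩
  · right
    rw [IsEmbedding.subtypeVal.closure_eq_preimage_closure_image, mem_preimage,
      Subtype.image_preimage_coe, inter_eq_self_of_subset_right hDF]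
    exact hcl

theorem exists_of_finite [CompactSpace X] [T2Space X] (hX : IsScattered X) {P : Set X}
    (hP : P.Finite) : ∃ V, IsClopenStrongHausdorffSystem P V := by
  obtain ⟨U, hU, hdisj⟩ := hP.t2_separation
  choose V hV hxV hVU using fun x => hX.exists_isClopen (hU x).2 (hU x).1
  refine ⟨V, of_closure_subset (fun d _ => hV d) (fun d _ => hxV d) ?_ fun x hx => Or.inl ?_⟩
  · intro d hd e he x hxd hxe
    by_contra hne
    exact disjoint_left.1 (hdisj hd he hne) (hVU d hxd) (hVU e hxe)
  · rw [(hP.isClosed_biUnion fun d _ => (hV d).isClosed).closure_eq] at hx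
    simpa using hx

end IsClopenStrongHausdorffSystem

/-! ### Closed subspaces with prescribed germs -/

/-- The subspace obtained from `closure D` by attaching `N d` at each point `d` of `D`. -/
def attach (D : Set X) (N : X → Set X) : Set X := (⋃ d ∈ D, N d) ∪ closure D

section attach

variable {D : Set X} {V N : X → Set X}

theorem mem_attach_iff [T1Space X] (h : IsClopenStrongHausdorffSystem D V)
    (hN : ∀ d ∈ D, N d ⊆ V d) (hmem : ∀ d ∈ D, d ∈ N d) {d x : X} (hd : d ∈ D) (hx : x ∈ V d) :
    x ∈ attach D N ↔ x ∈ N d := by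
  refine ⟨?_, fun hxN => Or.inl (mem_biUnion hd hxN)⟩
  rintro (hxN | hcl)
  · obtain ⟨e, he, hxe⟩ := mem_iUnion₂.1 hxN
    rwa [h.eq_of_mem hd he hx (hN e he hxe)]
  · rw [(h.eq_of_mem_closure hd hx Subset.rfl hcl).2]
    exact hmem d hd

/-- This is the use of the closure equation of the system: a limit of the attached pieces lies in
one `V d`, where only `N d` counts, or in `closure D`. -/
theorem isClosed_attach (h : IsClopenStrongHausdorffSystem D V)
    (hN : ∀ d ∈ D, N d ⊆ V d) (hcl : ∀ d ∈ D, IsClosed (N d)) : IsClosed (attach D N) := by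
  refine isClosed_of_closure_subset ?_
  rw [attach, closure_union, closure_closure]
  refine union_subset (fun x hx => ?_) subset_union_right
  obtain ⟨d, hd, hxd⟩ | hxD :=
    h.mem_or_of_mem_closure (closure_mono (iUnion₂_mono fun d hd => hN d hd) hx)
  · refine Or.inl (mem_biUnion hd ?_)
    rw [← (hcl d hd).closure_eq]
    exact (h.mem_closure_of_mem hN hd hxd Subset.rfl hx).2
  · exact Or.inr hxD

theorem subset_attach : D ⊆ attach D N := subset_closure.trans subset_union_right

theorem sameGerm_attach [T1Space X] (h : IsClopenStrongHausdorffSystem D V)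
    (hN : ∀ d ∈ D, N d ⊆ V d) (hmem : ∀ d ∈ D, d ∈ N d) {d : X} (hd : d ∈ D) :
    SameGerm (⟨d, subset_attach hd⟩ : attach D N) (⟨d, hmem d hd⟩ : N d) :=
  SameGerm.of_subset _ _ (h.isClopen d hd).isOpen (h.mem d hd)
    fun _ hy => mem_attach_iff h hN hmem hd hy

end attach

theorem IsCO.exists_embedding [CompactSpace X] [T2Space X] (hX : IsCO X) {F : Set X}
    (hF : IsClosed F) : ∃ j : F → X, IsOpenEmbedding j ∧ IsClosedEmbedding j := by
  obtain ⟨U, hU, ⟨e⟩⟩ := hX F hF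
  exact ⟨Subtype.val ∘ e, hU.isOpen.isOpenEmbedding_subtypeVal.comp e.isOpenEmbedding,
    hU.isClosed.isClosedEmbedding_subtypeVal.comp e.isClosedEmbedding⟩

end COSpace

/-! ### Coloured sets and the ranks they reach -/

namespace COSpace

/-- From points that reach arbitrarily large `δ < Λ`, but not all of them, one selects a family of
regular cardinality all of whose large subfamilies are still cofinal in `Λ`. -/
theorem exists_regular_selection {X : Type u} {Λ : Ordinal.{u}} (hΛ : Order.IsSuccLimit Λ)
    (R : X → Ordinal.{u} → Prop) (hR : ∀ z δ ε, δ ≤ ε → R z ε → R z δ)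
    (h : ∀ δ < Λ, ∃ z, R z δ ∧ ∃ ε < Λ, ¬ R z ε) :
    ∃ (S : Set X) (γ : X → Ordinal.{u}), (Cardinal.mk S).IsRegular ∧ (∀ z ∈ S, R z (γ z)) ∧
      ∀ D ⊆ S, Cardinal.mk D = Cardinal.mk S → ∀ δ < Λ, ∃ z ∈ D, δ ≤ γ z := by
  -- The minimal order type of `C` is essential: its proper initial segments have cardinality below
  -- `Λ.cof`.
  obtain ⟨C, hC, hCtype⟩ := Ordinal.exists_ord_cof_eq Λ.ToType
  rw [Ordinal.cof_toType] at hCtype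
  have hCcard : Cardinal.mk C = Λ.cof := by
    rw [← Ordinal.card_type (α := C) (· < ·), hCtype, Cardinal.card_ord]
  let f : Λ.ToType → Ordinal.{u} := fun c => (Ordinal.ToType.mk.symm c : Iio Λ)
  have hfmono : ∀ a b, f a ≤ f b ↔ a ≤ b := fun a b => by simp [f]
  have hf : ∀ c, f c < Λ := fun c => (Ordinal.ToType.mk.symm c : Iio Λ).2
  have hcof : ∀ δ < Λ, ∃ c : C, δ ≤ f c := by
    intro δ hδ
    obtain ⟨c, hc, hle⟩ := hC (Ordinal.ToType.mk ⟨δ, hδ⟩)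
    refine ⟨⟨c, hc⟩, ?_⟩
    have := (hfmono _ _).2 hle
    simpa [f] using this
  choose z hz ε hε hzε using fun c : C => h (f c) (hf c)
  have hsec : ∀ x : range z, ∃ c, z c = x := fun x => x.2
  choose s hs using hsec
  have hSle : Cardinal.mk (range z) ≤ Λ.cof := hCcard ▸ Cardinal.mk_range_le
  have hScard : Cardinal.mk (range z) = Λ.cof := by
    -- With fewer than `Λ.cof` points, the failure bounds `ε` would have a common bound below `Λ`,
    -- contradicting that some point reaches an index beyond it.
    refine hSle.eq_of_not_lt fun hlt => ?_
    have hsup := Ordinal.iSup_lt_of_lt_cof hlt fun x => hε (s x)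
    obtain ⟨c, hc⟩ := hcof _ hsup
    let x : range z := ⟨z c, mem_range_self c⟩
    refine hzε (s x) (hR _ _ (f c) ((Ordinal.le_iSup (fun x => ε (s x)) x).trans hc) ?_)
    rw [hs]
    exact hz c
  classical
  refine ⟨range z, fun x => if hx : x ∈ range z then f (s ⟨x, hx⟩) else 0, ?_, ?_, ?_⟩
  · rw [hScard]; exact Cardinal.isRegular_cof hΛ
  · intro x hx
    simp only [hx, dif_pos]
    have := hz (s ⟨x, hx⟩)
    rwa [hs] at this
  · intro D hD hDcard δ hδ
    by_contra! hcon
    obtain ⟨b, hb⟩ := hcof δ hδ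
    have hlt : ∀ x : D, s ⟨x, hD x.2⟩ < b := by
      intro x
      have h1 := hcon x x.2
      simp only [hD x.2, dif_pos] at h1
      by_contra! hle
      exact (h1.trans_le hb).not_ge ((hfmono _ _).2 hle)
    -- A non-cofinal `D` injects into an initial segment of `C`, which is too small.
    have hinj : Function.Injective fun x : D => (⟨s ⟨x, hD x.2⟩, hlt x⟩ : Iio b) := by
      intro x y hxy
      have h1 : s ⟨x, hD x.2⟩ = s ⟨y, hD y.2⟩ := congrArg Subtype.val hxy
      have h2 := congrArg z h1
      rw [hs, hs] at h2
      exact Subtype.ext h2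
    have h1 : Cardinal.mk D ≤ Cardinal.mk (Iio b) := Cardinal.mk_le_of_injective hinj
    have h2 : Cardinal.mk (Iio b) < Λ.cof := by
      have := Ordinal.typein_lt_type (α := C) (· < ·) b
      rw [hCtype, Cardinal.lt_ord] at this
      exact this
    rw [hDcard, hScard] at h1
    exact h1.not_gt h2

variable {X Y Z : Type u} [TopologicalSpace X] [TopologicalSpace Y] [TopologicalSpace Z]

/-- `D` is a set of points of `T` with a clopen strong Hausdorff system, coloured in such a way that
every colour accumulates at every accumulation point of `D`. -/
structure IsColored (T D : Set X) (c : X → ℕ) : Prop where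
  subset : D ⊆ T
  exists_system : ∃ V, IsClopenStrongHausdorffSystem D V
  accumulates : ∀ n, closure D \ D ⊆ closure (D ∩ c ⁻¹' {n})

/-- `z` has rank at least `γ` in the set of accumulation points of some coloured subset of `T`. -/
def Reaches (T : Set X) (z : X) (γ : Ordinal.{u}) : Prop :=
  ∃ D c, IsColored T D c ∧ z ∈ iteratedDerivedSet (closure D \ D) γ

theorem Reaches.mono {T : Set X} {z : X} {γ δ : Ordinal.{u}} (h : γ ≤ δ) (hz : Reaches T z δ) :
    Reaches T z γ := by
  obtain ⟨D, c, hD, hzD⟩ := hz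
  exact ⟨D, c, hD, iteratedDerivedSet_antitone _ h hzD⟩

theorem mem_closure_inter_of_isOpen {A W : Set X} (hW : IsOpen W) {x : X} (hx : x ∈ W) :
    x ∈ closure (A ∩ W) ↔ x ∈ closure A :=
  ⟨fun h => closure_mono inter_subset_left h, fun h => mem_closure_iff.2 fun U hU hxU => by
    obtain ⟨y, ⟨hyU, hyW⟩, hyA⟩ := mem_closure_iff.1 h (U ∩ W) (hU.inter hW) ⟨hxU, hx⟩
    exact ⟨y, hyU, hyA, hyW⟩⟩

theorem mem_closure_congr {A B W : Set X} (hW : IsOpen W) {x : X} (hx : x ∈ W)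
    (h : A ∩ W = B ∩ W) : x ∈ closure A ↔ x ∈ closure B := by
  rw [← mem_closure_inter_of_isOpen hW hx, h, mem_closure_inter_of_isOpen hW hx]

/-- Restrict the witness for each `z` to `W z` and take the union. Inside `W z` nothing changes, so
local ranks survive. A limit outside all `W z` is a limit of points of `S`, and these are already
limits of every colour. -/
theorem exists_isColored_of_reaches [T1Space X] {S T : Set X} {W : X → Set X}
    (hS : IsClopenStrongHausdorffSystem S W) (γ : X → Ordinal.{u})
    (h : ∀ z ∈ S, Reaches T z (γ z)) :
    ∃ D c, IsColored T D c ∧ ∀ z ∈ S, z ∈ iteratedDerivedSet (closure D \ D) (γ z) := by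
  classical
  choose! D c hD hz using h
  choose! V hV using fun z hz => (hD z hz).exists_system
  -- `ζ x` is the index of the unique piece containing `x`; outside the pieces its value is
  -- irrelevant.
  obtain ⟨ζ, hζ⟩ : ∃ ζ : X → X, ∀ z ∈ S, ∀ x ∈ W z, ζ x = z := by
    refine ⟨fun x => if hx : ∃ z ∈ S, x ∈ W z then hx.choose else x, fun z hz x hx => ?_⟩
    have hex : ∃ z ∈ S, x ∈ W z := ⟨z, hz, hx⟩
    simp only [hex, dif_pos]
    exact hS.eq_of_mem hex.choose_spec.1 hz hex.choose_spec.2 hx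
  set E : Set X := ⋃ z ∈ S, D z ∩ W z with hE
  have hmemE : ∀ {x}, x ∈ E ↔ ∃ z ∈ S, x ∈ D z ∧ x ∈ W z := by
    intro x; rw [hE]; exact mem_iUnion₂.trans (by simp only [mem_inter_iff, exists_prop])
  have hEW : ∀ z ∈ S, E ∩ W z = D z ∩ W z := by
    intro z hz
    ext x
    constructor
    · rintro ⟨hx, hxz⟩
      obtain ⟨w, hw, hxw, hxW⟩ := hmemE.1 hx
      exact hS.eq_of_mem hw hz hxW hxz ▸ ⟨hxw, hxW⟩
    · rintro ⟨hx, hxz⟩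
      exact ⟨hmemE.2 ⟨z, hz, hx, hxz⟩, hxz⟩
  have hEmem : ∀ z ∈ S, ∀ x ∈ W z, x ∈ E ↔ x ∈ D z := fun z hz x hx => by
    simpa [hx] using Set.ext_iff.1 (hEW z hz) x
  have hclE : ∀ z ∈ S, ∀ x ∈ W z, x ∈ closure E ↔ x ∈ closure (D z) := fun z hz x hx =>
    mem_closure_congr (hS.isClopen z hz).isOpen hx (hEW z hz)
  have hacc : ∀ z ∈ S, ∀ x ∈ W z, x ∈ closure E \ E ↔ x ∈ closure (D z) \ D z :=
    fun z hz x hx => and_congr (hclE z hz x hx) (not_congr (hEmem z hz x hx))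
  have hzacc : ∀ z ∈ S, z ∈ closure (D z) \ D z := fun z hzS =>
    iteratedDerivedSet_subset _ _ (hz z hzS)
  have hsubW : E ⊆ ⋃ z ∈ S, W z := iUnion₂_mono fun z _ => inter_subset_right
  refine ⟨E, fun x => c (ζ x) x, ⟨?_, ⟨fun x => V (ζ x) x ∩ W (ζ x), ?_⟩, ?_⟩, ?_⟩
  · intro x hx
    obtain ⟨z, hz, hxz, -⟩ := hmemE.1 hx
    exact (hD z hz).subset hxz
  · refine IsClopenStrongHausdorffSystem.of_closure_subset ?_ ?_ ?_ ?_
    · intro x hx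
      obtain ⟨z, hz, hxz, hxW⟩ := hmemE.1 hx
      rw [hζ z hz x hxW]
      exact ((hV z hz).isClopen x hxz).inter (hS.isClopen z hz)
    · intro x hx
      obtain ⟨z, hz, hxz, hxW⟩ := hmemE.1 hx
      rw [hζ z hz x hxW]
      exact ⟨(hV z hz).mem x hxz, hxW⟩
    · intro x hx y hy w hwx hwy
      obtain ⟨z, hz, hxz, hxW⟩ := hmemE.1 hx
      obtain ⟨z', hz', hyz, hyW⟩ := hmemE.1 hy
      rw [hζ z hz x hxW] at hwx
      rw [hζ z' hz' y hyW] at hwy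
      obtain rfl := hS.eq_of_mem hz hz' hwx.2 hwy.2
      exact (hV z hz).eq_of_mem hxz hyz hwx.1 hwy.1
    · intro x hx
      have hsub : (⋃ d ∈ E, V (ζ d) d ∩ W (ζ d)) ⊆ ⋃ z ∈ S, W z := by
        refine iUnion₂_subset fun d hd => ?_
        obtain ⟨z, hz, hxz, hxW⟩ := hmemE.1 hd
        rw [hζ z hz d hxW]
        exact inter_subset_right.trans (subset_biUnion_of_mem (u := W) hz)
      obtain ⟨z, hz, hxz⟩ | hxS := hS.mem_or_of_mem_closure (closure_mono hsub hx)
      · have hres := (hV z hz).inter (hS.isClopen z hz)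
        have hx' : x ∈ closure (⋃ d ∈ D z ∩ W z, V z d ∩ W z) := by
          rw [← mem_closure_inter_of_isOpen (hS.isClopen z hz).isOpen hxz] at hx
          refine closure_mono ?_ hx
          rintro w ⟨hw, hwz⟩
          obtain ⟨d, hd, hwd⟩ := mem_iUnion₂.1 hw
          obtain ⟨z', hz', hdz, hdW⟩ := hmemE.1 hd
          rw [hζ z' hz' d hdW] at hwd
          obtain rfl := hS.eq_of_mem hz' hz hwd.2 hwz
          exact mem_biUnion ⟨hdz, hdW⟩ hwd
        obtain ⟨d, hd, hxd⟩ | hcl := hres.mem_or_of_mem_closure hx'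
        · refine Or.inl ⟨d, hmemE.2 ⟨z, hz, hd⟩, ?_⟩
          rw [hζ z hz d hd.2]
          exact hxd
        · exact Or.inr ((hclE z hz x hxz).2 (closure_mono inter_subset_left hcl))
      · right
        refine closure_minimal (fun z hz => ?_) isClosed_closure hxS
        exact (hclE z hz z (hS.mem z hz)).2 (hzacc z hz).1
  · intro n x hx
    have key : ∀ z ∈ S, ∀ y ∈ W z, y ∈ closure (D z) \ D z →
        y ∈ closure (E ∩ (fun x => c (ζ x) x) ⁻¹' {n}) := by
      intro z hz y hy hyz
      have h1 := (hD z hz).accumulates n hyz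
      refine (mem_closure_congr (hS.isClopen z hz).isOpen hy ?_).1 h1
      ext w
      constructor
      · rintro ⟨⟨hw, hwn⟩, hwz⟩
        refine ⟨⟨(hEmem z hz w hwz).2 hw, ?_⟩, hwz⟩
        simpa [hζ z hz w hwz] using hwn
      · rintro ⟨⟨hw, hwn⟩, hwz⟩
        refine ⟨⟨(hEmem z hz w hwz).1 hw, ?_⟩, hwz⟩
        simpa [hζ z hz w hwz] using hwn
    obtain ⟨z, hz, hxz⟩ | hxS := hS.mem_or_of_mem_closure (closure_mono hsubW hx.1)
    · exact key z hz x hxz ((hacc z hz x hxz).1 hx)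
    · exact closure_minimal (fun z hz => key z hz z (hS.mem z hz) (hzacc z hz))
        isClosed_closure hxS
  · intro z hzS
    exact (mem_iteratedDerivedSet_congr (hS.isClopen z hzS).isOpen (hacc z hzS) _
      (hS.mem z hzS)).2 (hz z hzS)

theorem IsColored.isClosed [T1Space X] {T D : Set X} {c : X → ℕ} (h : IsColored T D c) :
    IsClosed (closure D \ D) := by
  obtain ⟨V, hV⟩ := h.exists_system
  exact hV.isClosed_closure_diff

theorem iteratedDerivedSet_limit_nonempty [CompactSpace X] {A : Set X} (hA : IsClosed A)
    {Λ : Ordinal.{u}} (hΛ : Order.IsSuccLimit Λ)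
    (h : ∀ δ < Λ, (iteratedDerivedSet A δ).Nonempty) : (iteratedDerivedSet A Λ).Nonempty := by
  rw [iteratedDerivedSet_limit hΛ]
  have : Nonempty (Iio Λ) := ⟨⟨0, hΛ.bot_lt⟩⟩
  refine IsCompact.nonempty_iInter_of_directed_nonempty_isCompact_isClosed _ ?_
    (fun b => h b b.2) (fun b => (isClosed_iteratedDerivedSet hA b).isCompact)
    (fun b => isClosed_iteratedDerivedSet hA b)
  intro a b
  refine ⟨max a b, iteratedDerivedSet_antitone _ ?_, iteratedDerivedSet_antitone _ ?_⟩
  · exact Subtype.coe_le_coe.2 (le_max_left a b)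
  · exact Subtype.coe_le_coe.2 (le_max_right a b)

theorem exists_infinite_system
    (hSys : ∀ S : Set X, (Cardinal.mk S).IsRegular →
      ∃ D ⊆ S, Cardinal.mk D = Cardinal.mk S ∧
        ∃ V : X → Set X, IsClopenStrongHausdorffSystem D V)
    {T : Set X} (hT : T.Infinite) :
    ∃ D ⊆ T, D.Infinite ∧ ∃ V, IsClopenStrongHausdorffSystem D V := by
  let f : ℕ → X := fun n => hT.natEmbedding T n
  have hf : Function.Injective f := Subtype.val_injective.comp (hT.natEmbedding T).injective
  have hcard : Cardinal.mk (range f) = Cardinal.aleph0 := by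
    have := Cardinal.mk_range_eq_of_injective hf
    simpa using this
  obtain ⟨D, hD, hDcard, V, hV⟩ := hSys (range f) (hcard ▸ Cardinal.isRegular_aleph0)
  refine ⟨D, hD.trans (range_subset_iff.2 fun n => (hT.natEmbedding T n).2), ?_, V, hV⟩
  rw [← infinite_coe_iff, Cardinal.infinite_iff, hDcard, hcard]

theorem exists_coloring_of_infinite {α : Type*} {D : Set α} (hD : D.Infinite) :
    ∃ c : α → ℕ, ∀ n, (D ∩ c ⁻¹' {n}).Infinite := by
  let f : ℕ → α := fun n => hD.natEmbedding D n
  have hf : Function.Injective f := Subtype.val_injective.comp (hD.natEmbedding D).injective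
  refine ⟨fun x => (Nat.unpair (Function.invFun f x)).1, fun n => ?_⟩
  refine infinite_of_injective_forall_mem (f := fun k => f (Nat.pair n k)) ?_ fun k => ⟨?_, ?_⟩
  · intro k l hkl
    exact (Nat.pair_eq_pair.1 (hf hkl)).2
  · exact (hD.natEmbedding D _).2
  · simp [Function.leftInverse_invFun hf (Nat.pair n k)]

/-! ### The largest rank reached -/

section CompactSpace

variable [CompactSpace X] [T2Space X]

theorem exists_reaches_zero (hX : IsScattered X)
    (hSys : ∀ S : Set X, (Cardinal.mk S).IsRegular →
      ∃ D ⊆ S, Cardinal.mk D = Cardinal.mk S ∧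
        ∃ V : X → Set X, IsClopenStrongHausdorffSystem D V)
    {T : Set X} (hT : T.Infinite) : ∃ z, Reaches T z 0 := by
  obtain ⟨D, hDT, hDinf, V, hV⟩ := exists_infinite_system hSys hT
  obtain ⟨x₀, -, hx₀⟩ := hDinf.exists_accPt_of_subset_isCompact isCompact_univ (subset_univ _)
  -- Near an isolated point `p` of the derived set, `D` converges to `p`; hence any splitting into
  -- infinite colour classes makes all colours accumulate there.
  obtain ⟨p, hp, U, hU, hUp⟩ := hX (derivedSet D) ⟨x₀, hx₀⟩
  have hpU : p ∈ U := (hUp.ge (mem_singleton p)).1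
  obtain ⟨W, hW, hpW, hWU⟩ := hX.exists_isClopen hU hpU
  have hacc : ∀ B ⊆ D, ∀ x ∈ W, AccPt x (𝓟 B) → x = p := fun B hB x hx hxB =>
    hUp.le ⟨hWU hx, hxB.mono (principal_mono.2 hB)⟩
  have hinf : ∀ B ⊆ D ∩ W, B.Infinite → p ∈ closure B := by
    intro B hB hBinf
    obtain ⟨x, hxW, hx⟩ := hBinf.exists_accPt_of_subset_isCompact hW.isClosed.isCompact
      (hB.trans inter_subset_right)
    rw [← hacc B (hB.trans inter_subset_left) x hxW hx]
    exact derivedSet_subset_closure B hx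
  have hDW : (D ∩ W).Infinite := by
    intro hfin
    have hopen : IsOpen (W \ ((D ∩ W) \ {p})) := hW.isOpen.sdiff hfin.sdiff.isClosed
    obtain ⟨y, ⟨⟨hyW, hyn⟩, hyD⟩, hne⟩ :=
      accPt_iff_nhds.1 hp _ (hopen.mem_nhds ⟨hpW, fun h => h.2 rfl⟩)
    exact hyn ⟨⟨hyD, hyW⟩, hne⟩
  have hsub : closure (D ∩ W) \ (D ∩ W) ⊆ {p} := by
    rintro x ⟨hx, hxn⟩
    have hxW : x ∈ W := hW.isClosed.closure_subset_iff.2 inter_subset_right hx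
    rw [closure_eq_self_union_derivedSet] at hx
    exact hacc _ inter_subset_left x hxW (hx.resolve_left hxn)
  have hpD : p ∉ D := by
    intro hpD
    obtain ⟨y, ⟨hyV, hyD⟩, hne⟩ :=
      accPt_iff_nhds.1 hp _ ((hV.isClopen p hpD).isOpen.mem_nhds (hV.mem p hpD))
    exact hne (hV.eq_of_mem hyD hpD (hV.mem y hyD) hyV)
  obtain ⟨c, hc⟩ := exists_coloring_of_infinite hDW
  refine ⟨p, D ∩ W, c, ⟨inter_subset_left.trans hDT, ⟨_, hV.inter hW⟩, fun n => ?_⟩, ?_⟩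
  · exact hsub.trans (singleton_subset_iff.2 (hinf _ inter_subset_left (hc n)))
  · rw [iteratedDerivedSet_zero]
    exact ⟨hinf _ Subset.rfl hDW, fun h => hpD h.1⟩

/-- Points reaching cofinally many ranks below `Λ` glue to one coloured set, and compactness gives a
point of rank `Λ`. The selection needs points that do not reach every rank below `Λ`, and
scatteredness provides them. -/
theorem not_isSuccLimit_of_minimal (hX : IsScattered X)
    (hSys : ∀ S : Set X, (Cardinal.mk S).IsRegular →
      ∃ D ⊆ S, Cardinal.mk D = Cardinal.mk S ∧
        ∃ V : X → Set X, IsClopenStrongHausdorffSystem D V)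
    {T : Set X} {Λ : Ordinal.{u}} (hΛ : ∀ z, ¬ Reaches T z Λ)
    (hlt : ∀ δ < Λ, ∃ z, Reaches T z δ) : ¬ Order.IsSuccLimit Λ := by
  intro hlim
  have hsel : ∀ δ < Λ, ∃ z, Reaches T z δ ∧ ∃ ε < Λ, ¬ Reaches T z ε := by
    by_contra! hcon
    obtain ⟨δ, hδ, hcon⟩ := hcon
    obtain ⟨z₀, hz₀⟩ := hlt δ hδ
    -- Otherwise reaching `δ` implies reaching everything below `Λ`. But `q` reaches `δ + 1`, so
    -- points reaching `δ` accumulate at it, against its isolation.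
    obtain ⟨q, hq, U, hU, hUq⟩ := hX {z | ∀ ε < Λ, Reaches T z ε} ⟨z₀, hcon z₀ hz₀⟩
    obtain ⟨D, c, hD, hqD⟩ := hq (δ + 1) (hlim.add_one_lt hδ)
    obtain ⟨-, hacc⟩ := mem_iteratedDerivedSet_succ.1 hqD
    have hqU : q ∈ U := (hUq.ge (mem_singleton q)).1
    obtain ⟨y, ⟨hyU, hyD⟩, hne⟩ := accPt_iff_nhds.1 hacc U (hU.mem_nhds hqU)
    exact hne (hUq.le ⟨hyU, hcon y ⟨D, c, hD, hyD⟩⟩)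
  obtain ⟨S, γ, hreg, hγ, hcof⟩ :=
    exists_regular_selection hlim (Reaches T) (fun z δ ε h hz => hz.mono h) hsel
  obtain ⟨D, hDS, hcard, W, hW⟩ := hSys S hreg
  obtain ⟨E, c, hE, hz⟩ := exists_isColored_of_reaches hW γ fun z hz => hγ z (hDS hz)
  obtain ⟨x, hx⟩ := iteratedDerivedSet_limit_nonempty hE.isClosed hlim fun δ hδ => by
    obtain ⟨z, hzD, hle⟩ := hcof D hDS hcard δ hδ
    exact ⟨z, iteratedDerivedSet_antitone _ hle (hz z hzD)⟩
  exact hΛ x ⟨E, c, hE, hx⟩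

theorem exists_maximal_reaches (hX : IsScattered X)
    (hSys : ∀ S : Set X, (Cardinal.mk S).IsRegular →
      ∃ D ⊆ S, Cardinal.mk D = Cardinal.mk S ∧
        ∃ V : X → Set X, IsClopenStrongHausdorffSystem D V)
    {T : Set X} (hT : T.Infinite) :
    ∃ γ : Ordinal.{u}, (∃ z, Reaches T z γ) ∧ ∀ z, ¬ Reaches T z (γ + 1) := by
  have hex : ∃ Λ : Ordinal.{u}, ∀ z, ¬ Reaches T z Λ := by
    obtain ⟨Λ, hΛ⟩ := hX.iteratedDerivedSet_eq_empty univ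
    refine ⟨Λ, ?_⟩
    rintro z ⟨D, c, -, hz⟩
    exact (hΛ.le (iteratedDerivedSet_mono (subset_univ _) Λ hz)).elim
  let Λ := sInf {Λ : Ordinal.{u} | ∀ z, ¬ Reaches T z Λ}
  have hΛ : ∀ z, ¬ Reaches T z Λ := csInf_mem hex
  have hlt : ∀ δ < Λ, ∃ z, Reaches T z δ := fun δ hδ => by
    have := notMem_of_lt_csInf' hδ
    simpa using this
  obtain h0 | ⟨γ, hγ⟩ | hlim := Ordinal.zero_or_succ_or_isSuccLimit Λ
  · obtain ⟨z, hz⟩ := exists_reaches_zero hX hSys hT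
    exact (hΛ z (h0 ▸ hz)).elim
  · exact ⟨γ, hlt γ (hγ ▸ lt_add_one γ), fun z => by
      rw [← Order.succ_eq_add_one, hγ]; exact hΛ z⟩
  · exact (not_isSuccLimit_of_minimal hX hSys hΛ hlt hlim).elim

/-- There is a largest rank `γ` reached, it is reached at finitely many points, and a single
coloured set reaches it at all of them. -/
theorem exists_isColored_maximal (hX : IsScattered X)
    (hSys : ∀ S : Set X, (Cardinal.mk S).IsRegular →
      ∃ D ⊆ S, Cardinal.mk D = Cardinal.mk S ∧
        ∃ V : X → Set X, IsClopenStrongHausdorffSystem D V)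
    {T : Set X} (hT : T.Infinite) :
    ∃ γ : Ordinal.{u}, {z | Reaches T z γ}.Finite ∧ {z | Reaches T z γ}.Nonempty ∧
      ∃ D c, IsColored T D c ∧ {z | Reaches T z γ} ⊆ iteratedDerivedSet (closure D \ D) γ := by
  obtain ⟨γ, hne, hmax⟩ := exists_maximal_reaches hX hSys hT
  have hfin : {z | Reaches T z γ}.Finite := by
    -- Infinitely many such points, glued together, would accumulate at a point reaching `γ + 1`.
    by_contra hinf
    obtain ⟨S, hS, hSinf, W, hW⟩ := exists_infinite_system hSys hinf
    obtain ⟨D, c, hD, hz⟩ := exists_isColored_of_reaches hW (fun _ => γ) fun z hz => hS hz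
    have hcl := isClosed_iteratedDerivedSet hD.isClosed γ
    obtain ⟨x, hx, hacc⟩ := hSinf.exists_accPt_of_subset_isCompact hcl.isCompact hz
    exact hmax x ⟨D, c, hD, mem_iteratedDerivedSet_succ.2 ⟨hx, hacc.mono (principal_mono.2 hz)⟩⟩
  obtain ⟨W, hW⟩ := IsClopenStrongHausdorffSystem.exists_of_finite hX hfin
  exact ⟨γ, hfin, hne, exists_isColored_of_reaches hW (fun _ => γ) fun z hz => hz⟩

end CompactSpace

/-- With infinitely many colours, one can be spent and the rest renumbered without losing any
accumulation point. -/
theorem IsColored.diff [T1Space X] {T D : Set X} {c : X → ℕ} (h : IsColored T D c) :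
    IsColored T (D \ c ⁻¹' {0}) (fun x => c x - 1) ∧
      closure (D \ c ⁻¹' {0}) \ (D \ c ⁻¹' {0}) = closure D \ D := by
  obtain ⟨V, hV⟩ := h.exists_system
  have hsub : ∀ n, D ∩ c ⁻¹' {n + 1} ⊆ D \ c ⁻¹' {0} := by
    rintro n x ⟨hx, hxn⟩
    refine ⟨hx, fun h0 => ?_⟩
    simp only [mem_preimage, mem_singleton_iff] at hxn h0
    omega
  have hacc : closure D \ D ⊆ closure (D \ c ⁻¹' {0}) :=
    (h.accumulates 1).trans (closure_mono (hsub 0))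
  have heq : closure (D \ c ⁻¹' {0}) \ (D \ c ⁻¹' {0}) = closure D \ D := by
    refine Subset.antisymm ?_ fun x hx => ⟨hacc hx, fun h => hx.2 h.1⟩
    rintro x ⟨hx, hxn⟩
    refine ⟨closure_mono sdiff_subset hx, fun hxD => hxn ?_⟩
    exact (hV.eq_of_mem_closure hxD (hV.mem x hxD) sdiff_subset hx).1
  refine ⟨⟨sdiff_subset.trans h.subset, ⟨V, hV.mono sdiff_subset hacc⟩, fun n => ?_⟩, heq⟩
  rw [heq]
  refine (h.accumulates (n + 1)).trans (closure_mono fun x hx => ⟨hsub n hx, ?_⟩)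
  have := hx.2
  simp only [mem_preimage, mem_singleton_iff] at this ⊢
  omega

/-- Coloured sets can be transported along a clopen embedding of a closed subspace. -/
theorem IsColored.reaches_of_embedding {T T' D : Set X} {c : X → ℕ} (h : IsColored T D c)
    {F : Set X} (hDF : closure D ⊆ F) {j : F → X} (hj : IsOpenEmbedding j)
    (hjc : IsClosedEmbedding j) (hT : ∀ d : F, (d : X) ∈ D → j d ∈ T') {γ : Ordinal.{u}} (z : F)
    (hz : (z : X) ∈ iteratedDerivedSet (closure D \ D) γ) : Reaches T' (j z) γ := by
  obtain ⟨V, hV⟩ := h.exists_system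
  have hD : D ⊆ F := subset_closure.trans hDF
  have hcl : ∀ B ⊆ F, closure (Subtype.val ⁻¹' B : Set F) = Subtype.val ⁻¹' closure B := by
    intro B hB
    rw [IsEmbedding.subtypeVal.closure_eq_preimage_closure_image, Subtype.image_preimage_coe,
      inter_eq_self_of_subset_right hB]
  have hE : closure (j '' (Subtype.val ⁻¹' D)) \ j '' (Subtype.val ⁻¹' D) =
      j '' (Subtype.val ⁻¹' (closure D \ D)) := by
    rw [hjc.closure_image_eq, hcl D hD, ← image_sdiff hj.injective, preimage_sdiff]
  refine ⟨j '' (Subtype.val ⁻¹' D), Function.extend j (fun y => c y) 0,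
    ⟨?_, ⟨_, (hV.comap hD).map hj hjc⟩, fun n => ?_⟩, ?_⟩
  · rintro _ ⟨d, hd, rfl⟩
    exact hT d hd
  · rw [hE]
    have h1 : j '' (Subtype.val ⁻¹' D) ∩ Function.extend j (fun y => c y) 0 ⁻¹' {n} =
        j '' (Subtype.val ⁻¹' (D ∩ c ⁻¹' {n})) := by
      ext x
      constructor
      · rintro ⟨⟨d, hd, rfl⟩, hn⟩
        rw [mem_preimage, hj.injective.extend_apply] at hn
        exact ⟨d, ⟨hd, hn⟩, rfl⟩
      · rintro ⟨d, ⟨hd, hn⟩, rfl⟩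
        refine ⟨⟨d, hd, rfl⟩, ?_⟩
        rw [mem_preimage, hj.injective.extend_apply]
        exact hn
    rw [h1, hjc.closure_image_eq, hcl _ (inter_subset_left.trans hD)]
    exact image_mono (preimage_mono (h.accumulates n))
  · rw [hE, iteratedDerivedSet_image hj.isEmbedding]
    refine mem_image_of_mem _ ?_
    have h2 : (Subtype.val '' (Subtype.val ⁻¹' (closure D \ D) : Set F)) = closure D \ D := by
      rw [Subtype.image_preimage_coe, inter_eq_self_of_subset_right (sdiff_subset.trans hDF)]
    rw [← h2, iteratedDerivedSet_image .subtypeVal] at hz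
    exact Subtype.val_injective.mem_set_image.1 hz

end COSpace

/-! ### Germs in CO spaces -/

namespace COSpace

theorem exists_preimage_of_finite {α : Type*} {P F : Set α} (hP : P.Finite) (hPF : P ⊆ F)
    {j : F → α} (hj : Function.Injective j) (hmaps : ∀ z : F, (z : α) ∈ P → j z ∈ P) {z : α}
    (hz : z ∈ P) : ∃ w : F, (w : α) ∈ P ∧ j w = z := by
  have := hP.to_subtype
  let g : P → P := fun w => ⟨j ⟨w, hPF w.2⟩, hmaps _ w.2⟩
  have hg : Function.Injective g := fun a b hab =>
    Subtype.ext (congrArg Subtype.val (hj (congrArg Subtype.val hab)) :)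
  obtain ⟨w, hw⟩ := Finite.surjective_of_injective hg ⟨z, hz⟩
  exact ⟨⟨w, hPF w.2⟩, w.2, congrArg Subtype.val hw⟩

variable {X : Type u} [TopologicalSpace X]

/-- The tops of the closed subspaces of `X` with the germ of `L` at `e`. -/
def germPoints (X : Type u) [TopologicalSpace X] {L : Type u} [TopologicalSpace L] (e : L) :
    Set X :=
  {x | ∃ A : Set X, IsClosed A ∧ ∃ hx : x ∈ A, SameGerm (⟨x, hx⟩ : A) e}

theorem sameGerm_mem_germPoints {L : Type u} [TopologicalSpace L] {e : L} {x : X}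
    (h : SameGerm x e) : x ∈ germPoints X e :=
  ⟨univ, isClosed_univ, trivial,
    (SameGerm.of_subset_univ _ isOpen_univ trivial Subset.rfl).trans h⟩

theorem IsUnitary.top_mem_germPoints [T2Space X] {A : Set X} (hA : IsUnitary A) {L : Type u}
    [TopologicalSpace L] {e : L} (h : SameGerm hA.top e) : (hA.top : X) ∈ germPoints X e :=
  ⟨A, (isCompact_iff_compactSpace.2 hA.compact).isClosed, hA.top.2, h⟩

variable [CompactSpace X] [T2Space X]

theorem IsScattered.exists_isClopen_isolating (hX : IsScattered X) {x : X} {α : Ordinal.{u}}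
    (hx : x ∈ cbDeriv X α) (hx' : x ∉ cbDeriv X (α + 1)) :
    ∃ W, IsClopen W ∧ x ∈ W ∧ ∀ y ∈ W, y ∈ cbDeriv X α → y = x := by
  have hacc : ¬ AccPt x (𝓟 (cbDeriv X α)) := fun h =>
    hx' (mem_iteratedDerivedSet_succ.2 ⟨hx, h⟩)
  rw [accPt_iff_nhds] at hacc
  push Not at hacc
  obtain ⟨U, hU, hUx⟩ := hacc
  obtain ⟨O, hOU, hO, hxO⟩ := mem_nhds_iff.1 hU
  obtain ⟨W, hW, hxW, hWO⟩ := hX.exists_isClopen hO hxO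
  exact ⟨W, hW, hxW, fun y hy hyα => hUx y ⟨hOU (hWO hy), hyα⟩⟩

/-- A germ of a closed subspace of `L` at `e` is found in a closed subspace of any clopen
neighbourhood of a point with the germ of `L` at `e`. -/
theorem exists_isClosed_sameGerm (hX : IsScattered X) {L M : Type u} [TopologicalSpace L]
    [TopologicalSpace M] {e : L} {m : M} {N : Set L} (hN : IsClosed N) (heN : e ∈ N)
    (hNm : SameGerm (⟨e, heN⟩ : N) m) {x : X} (hx : SameGerm x e) {V : Set X} (hV : IsClopen V)
    (hxV : x ∈ V) :
    ∃ A ⊆ V, IsClosed A ∧ ∃ hxA : x ∈ A, SameGerm (⟨x, hxA⟩ : A) m := by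
  obtain ⟨φ, hxφ, rfl⟩ := hx
  obtain ⟨W, hW, hxW, hWsub⟩ := hX.exists_isClopen (hV.isOpen.inter φ.open_source) ⟨hxV, hxφ⟩
  refine ⟨W ∩ φ ⁻¹' N, inter_subset_left.trans (hWsub.trans inter_subset_left),
    (φ.continuousOn.mono (hWsub.trans inter_subset_right)).preimage_isClosed_of_isClosed
      hW.isClosed hN, ⟨hxW, heN⟩, ?_⟩
  refine SameGerm.trans ?_ hNm
  exact SameGerm.of_openPartialHomeomorph φ _ _ hW.isOpen hxW (hWsub.trans inter_subset_right)
    fun y hy => by simp [hy]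

theorem not_isCO_of_infinite_sameGerm (hX : IsScattered X)
    (hSys : ∀ S : Set X, (Cardinal.mk S).IsRegular →
      ∃ D ⊆ S, Cardinal.mk D = Cardinal.mk S ∧
        ∃ V : X → Set X, IsClopenStrongHausdorffSystem D V)
    {L M : Type u} [TopologicalSpace L] [TopologicalSpace M] {e : L} {m : M} {α : Ordinal.{u}}
    (he : e ∈ cbDeriv L α) (he' : e ∉ cbDeriv L (α + 1)) (hm : m ∈ cbDeriv M α)
    (hm' : m ∉ cbDeriv M (α + 1)) (hne : ¬ SameGerm m e) {N : Set L} (hN : IsClosed N)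
    (heN : e ∈ N) (hNm : SameGerm (⟨e, heN⟩ : N) m) (hT : {x : X | SameGerm x e}.Infinite) :
    ¬ IsCO X := by
  intro hCO
  obtain ⟨γ, hfin, ⟨z, hz⟩, D, c, hD, hP⟩ := exists_isColored_maximal hX hSys hT
  obtain ⟨V, hV⟩ := hD.exists_system
  have hPcl : {z | Reaches {x : X | SameGerm x e} z γ} ⊆ closure D \ D :=
    hP.trans (iteratedDerivedSet_subset _ _)
  have hDα : ∀ d ∈ D, d ∈ cbDeriv X α := fun d hd => ((hD.subset hd).mem_cbDeriv_iff α).2 he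
  -- a subspace in which every point of `D` keeps its germ and the germ of `m` does not occur
  have hex₁ : ∀ d ∈ D, ∃ W, IsClopen W ∧ d ∈ W ∧ ∀ y ∈ W, y ∈ cbDeriv X α → y = d :=
    fun d hd => hX.exists_isClopen_isolating (hDα d hd) fun h =>
      he' (((hD.subset hd).mem_cbDeriv_iff _).1 h)
  choose! W hW hdW hWiso using hex₁
  let N₁ : X → Set X := fun d => V d ∩ W d
  have hN₁ : ∀ d ∈ D, N₁ d ⊆ V d := fun d _ => inter_subset_left
  have hN₁mem : ∀ d ∈ D, d ∈ N₁ d := fun d hd => ⟨hV.mem d hd, hdW d hd⟩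
  have hN₁clopen : ∀ d ∈ D, IsClopen (N₁ d) := fun d hd => (hV.isClopen d hd).inter (hW d hd)
  have hgerm₁ : ∀ d : attach D N₁, (d : X) ∈ D → SameGerm d e := fun d hd =>
    ((sameGerm_attach hV hN₁ hN₁mem hd).trans (SameGerm.of_subset_univ (hN₁mem d hd)
      (hN₁clopen d hd).isOpen (hN₁mem d hd) Subset.rfl)).trans (hD.subset hd)
  -- A point with germ `m` has level exactly `α`. In the pieces only points of `D` have level `α`,
  -- and their germ is that of `e`. The remaining points of `closure D` are limits of level-`α`
  -- points, so their level exceeds `α` if it reaches `α`.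
  have hno : ∀ y : attach D N₁, ¬ SameGerm y m := by
    intro y hy
    have hyα : y ∈ cbDeriv (attach D N₁) α := (hy.mem_cbDeriv_iff α).2 hm
    have hyX : (y : X) ∈ cbDeriv X α := mem_cbDeriv_of_isEmbedding .subtypeVal hyα
    by_cases hyD : (y : X) ∈ D
    · exact hne (hy.symm.trans (hgerm₁ y hyD))
    have hycl : (y : X) ∈ closure D := by
      obtain hyN | hycl := y.2
      · obtain ⟨d, hd, hyd⟩ := mem_iUnion₂.1 hyN
        exact (hyD (hWiso d hd y hyd.2 hyX ▸ hd)).elim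
      · exact hycl
    refine hm' ((hy.mem_cbDeriv_iff _).1 (mem_iteratedDerivedSet_succ.2 ⟨hyα, ?_⟩))
    rw [accPt_iff_nhds]
    intro U hU
    rw [nhds_induced] at hU
    obtain ⟨U', hU', hUU'⟩ := hU
    obtain ⟨d, hdU, hdD⟩ := mem_closure_iff_nhds.1 hycl U' hU'
    refine ⟨⟨d, subset_attach hdD⟩, ⟨hUU' hdU, ?_⟩, fun h => hyD (h ▸ hdD)⟩
    exact ((hgerm₁ ⟨d, subset_attach hdD⟩ hdD).mem_cbDeriv_iff α).2 he
  obtain ⟨j₁, hj₁, hj₁c⟩ := hCO.exists_embedding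
    (isClosed_attach hV hN₁ fun d hd => (hN₁clopen d hd).isClosed)
  have hF₁ : closure D ⊆ attach D N₁ := subset_union_right
  obtain ⟨w₁, -, hw₁z⟩ := exists_preimage_of_finite hfin
    ((hPcl.trans sdiff_subset).trans hF₁) hj₁.injective (fun w hw =>
      hD.reaches_of_embedding hF₁ hj₁ hj₁c (fun d hd =>
        (SameGerm.of_isOpenEmbedding hj₁ d).symm.trans (hgerm₁ d hd)) w (hP hw)) hz
  -- a subspace in which the points of colour `0` get the germ of `m`
  have hex₂ : ∀ d ∈ D, ∃ A ⊆ V d, IsClosed A ∧ ∃ hdA : d ∈ A,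
      SameGerm (⟨d, hdA⟩ : A) e ∧ c d ≠ 0 ∨ SameGerm (⟨d, hdA⟩ : A) m ∧ c d = 0 := by
    intro d hd
    by_cases hc : c d = 0
    · obtain ⟨A, hAV, hA, hdA, h⟩ := exists_isClosed_sameGerm hX hN heN hNm (hD.subset hd)
        (hV.isClopen d hd) (hV.mem d hd)
      exact ⟨A, hAV, hA, hdA, Or.inr ⟨h, hc⟩⟩
    · refine ⟨V d, Subset.rfl, (hV.isClopen d hd).isClosed, hV.mem d hd, Or.inl ⟨?_, hc⟩⟩
      exact (SameGerm.of_subset_univ _ (hV.isClopen d hd).isOpen (hV.mem d hd)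
        Subset.rfl).trans (hD.subset hd)
  choose! N₂ hN₂ hN₂cl hN₂mem hN₂germ using hex₂
  have hF₂ : closure D ⊆ attach D N₂ := subset_union_right
  obtain ⟨j₂, hj₂, hj₂c⟩ := hCO.exists_embedding (isClosed_attach hV hN₂ hN₂cl)
  have hgerm₂ : ∀ d : attach D N₂, (d : X) ∈ D →
      (SameGerm (j₂ d) e ∧ c d ≠ 0 ∨ SameGerm (j₂ d) m ∧ c d = 0) := by
    intro d hd
    have h := (SameGerm.of_isOpenEmbedding hj₂ d).symm.trans (sameGerm_attach hV hN₂ hN₂mem hd)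
    exact (hN₂germ d hd).imp (And.imp_left h.trans) (And.imp_left h.trans)
  obtain ⟨hD', hacc⟩ := hD.diff
  -- Only the colours other than `0` still have germ `e`, so the transported coloured set is `D`
  -- without colour `0`, with the same accumulation points.
  obtain ⟨w₂, hw₂, hw₂z⟩ := exists_preimage_of_finite hfin
    ((hPcl.trans sdiff_subset).trans hF₂) hj₂.injective (fun w hw =>
      hD'.reaches_of_embedding ((closure_mono sdiff_subset).trans hF₂) hj₂ hj₂c (fun d hd =>
        ((hgerm₂ d hd.1).resolve_right fun h => hd.2 h.2).1) w (hacc.symm ▸ hP hw)) hz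
  have hzr : z ∈ range j₁ := ⟨w₁, hw₁z⟩
  rw [← hw₂z] at hzr
  have hnhds := (hj₁.isOpen_range.preimage hj₂.continuous).mem_nhds hzr
  rw [nhds_induced] at hnhds
  obtain ⟨U, hU, hUsub⟩ := hnhds
  -- Colour `0` accumulates at `w₂`, so some point with germ `m` is sent by `j₂` into the open range
  -- of `j₁`.
  obtain ⟨d, hdU, hdD, hdc⟩ := mem_closure_iff_nhds.1 (hD.accumulates 0 (hPcl hw₂)) U hU
  have hdF : d ∈ attach D N₂ := subset_attach hdD
  obtain ⟨w, hw⟩ : j₂ ⟨d, hdF⟩ ∈ range j₁ := hUsub (a := ⟨d, hdF⟩) hdU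
  have hdm := ((hgerm₂ ⟨d, hdF⟩ hdD).resolve_left fun h => h.2 hdc).1
  rw [← hw] at hdm
  exact hno w ((SameGerm.of_isOpenEmbedding hj₁ w).trans hdm)

/-- In a CO space a system of germs carried by closed subspaces is realized in the space itself. -/
theorem IsCO.exists_injOn_sameGerm (hCO : IsCO X) {L : Type u} [TopologicalSpace L] {e : L}
    {D : Set X} {V : X → Set X} (hV : IsClopenStrongHausdorffSystem D V)
    (hD : D ⊆ germPoints X e) :
    ∃ f : X → X, InjOn f D ∧ ∀ d ∈ D, SameGerm (f d) e := by
  have hex : ∀ d ∈ D, ∃ A ⊆ V d, IsClosed A ∧ ∃ hdA : d ∈ A, SameGerm (⟨d, hdA⟩ : A) e := by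
    intro d hd
    obtain ⟨A, hA, hdA, h⟩ := hD hd
    refine ⟨A ∩ V d, inter_subset_right, hA.inter (hV.isClopen d hd).isClosed,
      ⟨hdA, hV.mem d hd⟩, ?_⟩
    exact (SameGerm.of_subset _ _ (hV.isClopen d hd).isOpen (hV.mem d hd)
      fun y hy => by simp [hy]).trans h
  choose! N hN hNcl hNmem hNgerm using hex
  obtain ⟨j, hj, -⟩ := hCO.exists_embedding (isClosed_attach hV hN hNcl)
  classical
  refine ⟨fun x => if hx : x ∈ attach D N then j ⟨x, hx⟩ else x, ?_, fun d hd => ?_⟩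
  · intro x hx y hy hxy
    simp only [subset_attach hx, subset_attach hy, dif_pos] at hxy
    exact congrArg Subtype.val (hj.injective hxy)
  · simp only [subset_attach hd, dif_pos]
    exact ((SameGerm.of_isOpenEmbedding hj _).symm.trans
      (sameGerm_attach hV hN hNmem hd)).trans (hNgerm d hd)

theorem IsCO.finite_germPoints (hX : IsScattered X)
    (hSys : ∀ S : Set X, (Cardinal.mk S).IsRegular →
      ∃ D ⊆ S, Cardinal.mk D = Cardinal.mk S ∧
        ∃ V : X → Set X, IsClopenStrongHausdorffSystem D V)
    {L M : Type u} [TopologicalSpace L] [TopologicalSpace M] (hL : IsUnitary L) (hM : IsUnitary M)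
    (hML : Prec hM hL) (hCO : IsCO X) : (germPoints X hL.top).Finite := by
  by_contra hinf
  obtain ⟨⟨K, hK, hKM⟩, hrk, hne⟩ := hML
  obtain ⟨D, hD, hDinf, V, hV⟩ := exists_infinite_system hSys hinf
  obtain ⟨f, hf, hfD⟩ := hCO.exists_injOn_sameGerm hV hD
  have hT : {x : X | SameGerm x hL.top}.Infinite :=
    (hDinf.image hf).mono (image_subset_iff.2 hfD)
  -- Here `rk M = rk L` matters: the top of the copy of `M` lies in the last nonempty derivative of
  -- `L`.
  have htop : (hK.top : L) = hL.top := by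
    have h := mem_cbDeriv_of_isEmbedding .subtypeVal hK.mem_cbDeriv_rk
    rw [hKM.rk_eq, hrk, hL.cbDeriv_rk] at h
    exact h
  have := hL.t2
  have := hK.compact
  have hKcl : IsClosed K := (isCompact_iff_compactSpace.2 hK.compact).isClosed
  have htopK : hL.top ∈ K := htop ▸ hK.top.2
  have hgerm : SameGerm (⟨hL.top, htopK⟩ : K) hM.top := by
    have : (⟨hL.top, htopK⟩ : K) = hK.top := Subtype.ext htop.symm
    rw [this]
    exact hKM.sameGerm
  refine not_isCO_of_infinite_sameGerm hX hSys hL.mem_cbDeriv_rk ?_ (hrk ▸ hM.mem_cbDeriv_rk) ?_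
    (fun h => hne h.almostHomeo) hKcl htopK hgerm hT hCO
  · rw [hL.cbDeriv_succ_rk]; exact notMem_empty _
  · rw [← hrk, hM.cbDeriv_succ_rk]; exact notMem_empty _

/-- Realizing all germ points at once by one clopen embedding injects the finite set `germPoints X
e` into itself; surjectivity puts `x` among the realized points. -/
theorem IsCO.sameGerm_of_mem_germPoints (hX : IsScattered X) (hCO : IsCO X) {L : Type u}
    [TopologicalSpace L] {e : L} (hfin : (germPoints X e).Finite) {x : X}
    (hx : x ∈ germPoints X e) : SameGerm x e := by
  obtain ⟨V, hV⟩ := IsClopenStrongHausdorffSystem.exists_of_finite hX hfin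
  obtain ⟨f, hf, hfD⟩ := hCO.exists_injOn_sameGerm hV Subset.rfl
  obtain ⟨d, hd, rfl⟩ := exists_preimage_of_finite hfin Subset.rfl hf.injective
    (fun d hd => sameGerm_mem_germPoints (hfD d hd)) hx
  exact hfD d hd

end COSpace

end

open COSpace in
theorem theorem3p2 (X : Type u) [TopologicalSpace X] [CompactSpace X] [T2Space X]
    (hX : IsScattered X)
    (hSys : ∀ S : Set X, (Cardinal.mk S).IsRegular →
      ∃ D ⊆ S, Cardinal.mk D = Cardinal.mk S ∧
        ∃ V : X → Set X, IsClopenStrongHausdorffSystem D V) :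
    (∀ (L M : Type u) [TopologicalSpace L] [TopologicalSpace M]
        (hL : IsUnitary L) (hM : IsUnitary M)
        (Li : ℕ → Set X) (hLi : ∀ i, IsUnitary (Li i)),
        Prec hM hL →
        (∀ i, AlmostHomeo (hLi i) hL) →
        (∀ i j, i < j → ((hLi i).top : X) ≠ (hLi j).top) →
        ¬ IsCO X) ∧
    (∀ (L M : Type u) [TopologicalSpace L] [TopologicalSpace M]
        (hL : IsUnitary L) (hM : IsUnitary M)
        (K : Set X) (hK : IsUnitary K),
        Prec hM hL → WPrec hL hK →
        ¬ IsCO X) := by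
  constructor
  · intro L M _ _ hL hM Li hLi hML hLiL hne hCO
    refine Set.infinite_of_injective_forall_mem (f := fun i => ((hLi i).top : X)) ?_ (fun i =>
      (hLi i).top_mem_germPoints (hLiL i).sameGerm) (hCO.finite_germPoints hX hSys hL hM hML)
    intro i j hij
    by_contra hne'
    obtain h | h := lt_or_gt_of_ne hne'
    · exact hne i j h hij
    · exact hne j i h hij.symm
  · rintro L M _ _ hL hM K hK hML ⟨⟨K', hK', hK'L, htop⟩, hLK⟩ hCO
    have hfin := hCO.finite_germPoints hX hSys hL hM hML
    have := hK.compact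
    obtain ⟨j, hj, hjc⟩ := hCO.exists_embedding (isCompact_iff_compactSpace.2 hK.compact).isClosed
    have hK'cl : IsClosed K' := (isCompact_iff_compactSpace.2 hK'.compact).isClosed
    -- The image of `K'` under the clopen embedding carries the germ of `L` at the image of the
    -- common top of `K'` and `K`.
    have hmem : j hK.top ∈ germPoints X hL.top := by
      have hmem' : hK.top ∈ K' := htop ▸ hK'.top.2
      refine ⟨j '' K', hjc.isClosedMap _ hK'cl, Set.mem_image_of_mem _ hmem', ?_⟩
      refine SameGerm.trans (SameGerm.symm ?_) hK'L.sameGerm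
      refine SameGerm.of_isEmbedding (i := j ∘ Subtype.val) (j := Subtype.val)
        (hj.isEmbedding.comp .subtypeVal) .subtypeVal ?_ isOpen_univ trivial ?_
      · simp [htop]
      · intro x _
        rw [Set.range_comp, Subtype.range_val, Subtype.range_val]
    have hjL := hCO.sameGerm_of_mem_germPoints hX hfin hmem
    exact hLK ((SameGerm.of_isOpenEmbedding hj hK.top).trans hjL).symm.almostHomeo
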